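/- **Patrol problem.** There are $I$ areas, $J$ agent types and a horizon $T$. For each area $i$ and type $j$ a neighbourhood $\mathscr B_{i,j}\subseteq[I]$ is given, with $i\in\mathscr B_{i,j}$, and $i\in\mathscr B_{i',j}$ implies $i'\in\mathscr B_{i,j}$. Each pair $(i,j)$ carries a controlled process with finite state space $\mathscr S_{i,j}$; a state $s$ consists of a knowledge component and an indicator $\mathcal i(s)\in\{0,1\}$ telling whether a type-$j$ agent is in area $i$. The process has a given initial distribution $\pi^0_{i,j}$, cost rates $c_{i,j}(s,e,t)\ge 0$ and transition probabilities $P_{i,j,t}(s,e,s')$, where $e\in\{0,1\}$ tells whether the area is explored in slot $t$; the indicator at $t+1$ equals $e$. For $e\in(0,1)$, $c_{i,j}$ and $P_{i,j,t}$ are interpolated linearly in $e$. In the problem scaled by $h\in\mathbb N_+$ each area $i$ is divided into $h$ sub-areas $(i,k)$, $k\in[h]$, and the state space is $\mathscr S^h=\prod_{i,j}(\mathscr S_{i,j})^h$. An action consists of variables $a^k_{i,i',j}\in\{0,1\}$ ($a^k_{i,i',j}=1$: an agent of type $j$ is moved from area $i'$ to sub-area $(i,k)$), with $a^k_{i,i',j}=0$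 if $i'\notin\mathscr B_{i,j}$. **Indices.** For $\gamma\in\mathbb R^{IJT}$ and $\alpha\in\mathscr A_{i,j}=\{\alpha\in[0,1]^I:\sum_{i'\in\mathscr B_{i,j}}\alpha_{i'}\le1,\ \alpha_{i'}=0\text{ for }i'\notin\mathscr B_{i,j}\}$ put $e(\alpha)=1-\prod_{i'}(1-\alpha_{i'})$ and $$Q^\gamma_{i,j}(s,\alpha,t;W)=c_{i,j}(s,e(\alpha),t)+\gamma_{i,j,t}\,\mathcal i(s)-\sum_{i'\in\mathscr B_{i,j}}\gamma_{i',j,t}\alpha_{i'}+\sum_{s'}P_{i,j,t}(s,e(\alpha),s')W(s').$$ Let $V^\gamma$ solve the Bellman equations $V^\gamma_{i,j}(s,t)=\min_{\alpha\in\mathscr A_{i,j}}Q^\gamma_{i,j}(s,\alpha,t;V^\gamma_{i,j}(\cdot,t+1))$, $V^\gamma_{i,j}(\cdot,T+1)=0$, and let $$\vartheta^\gamma_{i,j}(s,t)=c_{i,j}(s,1,t)-c_{i,j}(s,0,t)+\sum_{s'}\bigl(P_{i,j,t}(s,1,s')-P_{i,j,t}(s,0,s')\bigr)V^\gamma_{i,j}(s',t+1).$$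 Let $(\gamma^*,V^*)$ be an optimal solution of the linear program: maximise $\sum_{i,j,s}\pi^0_{i,j}(s)V_{i,j}(s,1)$ over $(\gamma,V)$ subject to $V_{i,j}(s,t)\le Q^\gamma_{i,j}(s,\alpha,t;V_{i,j}(\cdot,t+1))$ for all $i,j,t,s$ and $\alpha\in\mathscr A_{i,j}\cap\{0,1\}^I$, and $V_{i,j}(\cdot,T+1)=0$. The index is $\eta_{i,i',j}(s,t)=\vartheta^{\gamma^*}_{i,j}(s,t)-\gamma^*_{i',j,t}$ for $i'\in\mathscr B_{i,j}$, and $+\infty$ otherwise. **Index policy (IND).** In state $\boldsymbol s\in\mathscr S^h$ at time $t$, for each $j$, rank all movements $(i,k,i',j)$ with $i'\in\mathscr B_{i,j}$ and $\sum_{k'}\mathcal i(s^{k'}_{i',j})>0$ by ascending $\eta_{i,i',j}(s^k_{i,j},t)$; among movements to the same sub-area with equal indices the smaller $i'$ comes first, other ties are broken arbitrarily. Go through the ranking and take a movement exactly if its sub-area has not yet received a type-$j$ agent and area $i'$ still has an unmoved type-$j$ agent. **MAI policy.** Start from the action of IND. For each $j$, let $\varpi^k_{i,j}$ be the origin of the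 type-$j$ agent moved to $(i,k)$, with $\varpi^k_{i,j}=0$ if there is none (vacant sub-area). Distances $d_{i,j}$ are determined by: $d_{i,j}=\infty$ if area $i$ has no type-$j$ agent; otherwise $d_{i,j}=0$ if some sub-area in $\mathscr B_{i,j}\times[h]$ is vacant, and otherwise $d_{i,j}=1+\min d_{\varpi^{k'}_{i',j},j}$ over $(i',k')\in\mathscr B_{i,j}\times[h]$ with $\varpi^{k'}_{i',j}\ne i$ (with $\min\emptyset=\infty$). In an arbitrary order, treat each area $i$ that has type-$j$ agents not all of which are moved by IND; for each of its unmoved agents, one after the other, put $\bar i=i$ and repeat the following, the distances being kept fixed. Choose $(i^*,k^*)\in\mathscr B_{\bar i,j}\times[h]$ minimising $d_{\varpi^{k^*}_{i^*,j},j}$ (smallest $i^*$, arbitrary $k^*$ in case of ties), let $\varpi=\varpi^{k^*}_{i^*,j}$, and replace the movement $(i^*,k^*,\varpi,j)$ by $(i^*,k^*,\bar i,j)$. If $d_{\varpi,j}=0$, move the displaced agent from $\varpi$ to any vacant sub-area in $\mathscr B_{\varpi,j}\times[h]$, update the origins, recompute the distances and stop; otherwise update the origin of $(i^*,k^*)$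 and continue with $\bar i=\varpi$. **Lemma.** For every choice of the tie-breaking rules, the MAI algorithm terminates successfully for all $h\in\mathbb N_+$, $t\in[T]$, $\boldsymbol s\in\mathscr S^h$. The resulting actions are admissible (zero for $i'\notin\mathscr B_{i,j}$) and satisfy, for all such $h,t,\boldsymbol s$, $$\sum_{i'\in\mathscr B_{i,j}}a^{\mathrm{MAI},k}_{i,i',j}(\boldsymbol s,t)\le1\quad\forall i,j,k,\qquad \frac1h\sum_{i'\in\mathscr B_{i,j}}\sum_{k\in[h]}a^{\mathrm{MAI},k}_{i',i,j}(\boldsymbol s,t)=\frac1h\sum_{k\in[h]}\mathcal i(s^k_{i,j})\quad\forall i,j,$$ and, with $\|\cdot\|$ the Euclidean norm and the index policy using the same ranking, $$\bigl\|\boldsymbol a^{\mathrm{MAI},h}(\boldsymbol s,t)-\boldsymbol a^{\mathrm{IND},h}(\boldsymbol s,t)\bigr\|=o(h)\qquad(h\to\infty),$$ uniformly in $t\in[T]$ and $\boldsymbol s\in\mathscr S^h$. -/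

import Mathlib

open scoped BigOperators

/-- The multi-agent patrol problem with `I` areas, `J` agent types and horizon `T` (areas, types and
time slots are numbered from `0`).  A state of an area-agent pair is a pair `(knowledge, indicator)`,
the indicator telling whether an agent of that type is in the area. -/
structure PatrolProblem (I J T : ℕ) where
  /-- values of the controller's knowledge -/
  Knowledge : Fin I → Fin J → Type
  /-- the finite state space of the area-agent pair `(i, j)` -/
  space : ∀ i j, Finset (Knowledge i j × Bool)
  /-- the neighbourhood of area `i` for agents of type `j` -/
  nbhd : Fin I → Fin J → Finset (Fin I)
  self_mem_nbhd : ∀ i j, i ∈ nbhd i j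
  nbhd_symm : ∀ i i' j, i ∈ nbhd i' j → i' ∈ nbhd i j
  /-- cost rate `c i j s e t`; `e` tells whether the area is explored in slot `t` -/
  cost : ∀ i j, {x // x ∈ space i j} → Bool → Fin T → ℝ
  cost_nonneg : ∀ i j s e t, 0 ≤ cost i j s e t
  /-- transition probabilities `trans i j t s e s'` -/
  trans : ∀ i j, Fin T → {x // x ∈ space i j} → Bool → {x // x ∈ space i j} → ℝ
  trans_nonneg : ∀ i j t s e s', 0 ≤ trans i j t s e s'
  trans_sum : ∀ i j t s e, ∑ s', trans i j t s e s' = 1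
  /-- after slot `t` there is an agent in the area exactly if the area was explored in slot `t` -/
  trans_indicator : ∀ i j t s e s', trans i j t s e s' ≠ 0 → s'.1.2 = e
  /-- initial distribution -/
  init : ∀ i j, {x // x ∈ space i j} → ℝ
  init_nonneg : ∀ i j s, 0 ≤ init i j s
  init_sum : ∀ i j, ∑ s, init i j s = 1

/-- Sub-areas `(i, k)` of the problem scaled by `h`. -/
abbrev Slot (I h : ℕ) : Type := Fin I × Fin h

/-- A movement `((i, k), i')` of an agent (of a given type) from area `i'` to sub-area `(i, k)`. -/
abbrev Movement (I h : ℕ) : Type := Slot I h × Fin I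

/-- Action variables (with values in `{0, 1}`) for one agent type. -/
abbrev TypeAction (I h : ℕ) : Type := Movement I h → Bool

/-- Action variables for all agent types: `a j ((i, k), i')` is the action variable of moving an
agent of type `j` from area `i'` to sub-area `(i, k)`. -/
abbrev PatrolAction (I J h : ℕ) : Type := Fin J → TypeAction I h

/-- Origin of the agent that is moved to a sub-area; `none` if the sub-area is left vacant. -/
abbrev Origin (I h : ℕ) : Type := Slot I h → Option (Fin I)

/-- The action variables as a vector in Euclidean space. -/
noncomputable def PatrolAction.vec {I J h : ℕ} (a : PatrolAction I J h) :
    EuclideanSpace ℝ (Fin J × Movement I h) :=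
  WithLp.toLp 2 (fun x => ((a x.1 x.2).toNat : ℝ))

namespace PatrolProblem

variable {I J T : ℕ}

/-- States of the area-agent pair `(i, j)`. -/
abbrev State (P : PatrolProblem I J T) (i : Fin I) (j : Fin J) : Type := {x // x ∈ P.space i j}

/-- Indicator of the presence of an agent. -/
def indicator (P : PatrolProblem I J T) {i : Fin I} {j : Fin J} (s : P.State i j) : ℕ :=
  s.1.2.toNat

/-! ### Relaxation, dual linear program and indices -/

/-- Randomised actions of an area-agent pair in the relaxed problem. -/
def relaxedActions (P : PatrolProblem I J T) (i : Fin I) (j : Fin J) : Set (Fin I → ℝ) :=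
  {a | (∀ i', 0 ≤ a i' ∧ a i' ≤ 1) ∧ ∑ i' ∈ P.nbhd i j, a i' ≤ 1 ∧ ∀ i', i' ∉ P.nbhd i j → a i' = 0}

/-- Probability that the area is explored under the randomised action `a`. -/
def exploreProb (a : Fin I → ℝ) : ℝ := 1 - ∏ i', (1 - a i')

/-- Cost rate when the area is explored with probability `e`. -/
def mixedCost (P : PatrolProblem I J T) (i : Fin I) (j : Fin J) (s : P.State i j) (e : ℝ)
    (t : Fin T) : ℝ :=
  e * P.cost i j s true t + (1 - e) * P.cost i j s false t

/-- Transition probability when the area is explored with probability `e`. -/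
def mixedTrans (P : PatrolProblem I J T) (i : Fin I) (j : Fin J) (t : Fin T) (s : P.State i j)
    (e : ℝ) (s' : P.State i j) : ℝ :=
  e * P.trans i j t s true s' + (1 - e) * P.trans i j t s false s'

/-- Cost rate of a sub-problem under the multipliers `γ`. -/
def lagrangeCost (P : PatrolProblem I J T) (γ : Fin I → Fin J → Fin T → ℝ) (i : Fin I) (j : Fin J)
    (s : P.State i j) (a : Fin I → ℝ) (t : Fin T) : ℝ :=
  P.mixedCost i j s (exploreProb a) t + γ i j t * P.indicator s
    - ∑ i' ∈ P.nbhd i j, γ i' j t * a i'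

/-- Right-hand side of the Bellman equation before minimisation, `W` being the value function at
the next time. -/
def bellmanTerm (P : PatrolProblem I J T) (γ : Fin I → Fin J → Fin T → ℝ) (i : Fin I) (j : Fin J)
    (t : Fin T) (W : P.State i j → ℝ) (s : P.State i j) (a : Fin I → ℝ) : ℝ :=
  P.lagrangeCost γ i j s a t + ∑ s', P.mixedTrans i j t s (exploreProb a) s' * W s'

/-- Value function of a sub-problem: the solution of the Bellman equations, by backward recursion
from the value `0` at time `T + 1` (the last element of `Fin (T + 1)`). -/
noncomputable def value (P : PatrolProblem I J T) (γ : Fin I → Fin J → Fin T → ℝ) (i : Fin I)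
    (j : Fin J) : Fin (T + 1) → P.State i j → ℝ :=
  Fin.reverseInduction (motive := fun _ => P.State i j → ℝ) (fun _ => 0)
    (fun t W s => sInf (P.bellmanTerm γ i j t W s '' P.relaxedActions i j))

/-- The value function vanishes at the final time. -/
theorem value_last (P : PatrolProblem I J T) (γ : Fin I → Fin J → Fin T → ℝ) (i : Fin I)
    (j : Fin J) (s : P.State i j) : P.value γ i j (Fin.last T) s = 0 := by
  simp [value]

/-- The value function satisfies the Bellman equations, with an attained minimum. -/
theorem value_isLeast (P : PatrolProblem I J T) (γ : Fin I → Fin J → Fin T → ℝ) (i : Fin I)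
    (j : Fin J) (t : Fin T) (s : P.State i j) :
    IsLeast (P.bellmanTerm γ i j t (P.value γ i j t.succ) s '' P.relaxedActions i j)
      (P.value γ i j t.castSucc s) := by
  have hclosed : IsClosed (P.relaxedActions i j) := by
    have : P.relaxedActions i j = (⋂ i', {a : Fin I → ℝ | 0 ≤ a i' ∧ a i' ≤ 1}) ∩
        ({a | ∑ i' ∈ P.nbhd i j, a i' ≤ 1} ∩ ⋂ i', ⋂ (_ : i' ∉ P.nbhd i j), {a | a i' = 0}) := by
      ext a; simp [relaxedActions]
    rw [this]
    refine (isClosed_iInter fun i' => ?_).inter (IsClosed.inter ?_ ?_)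
    · exact (isClosed_le continuous_const (continuous_apply i')).inter
        (isClosed_le (continuous_apply i') continuous_const)
    · exact isClosed_le (continuous_finsetSum _ fun i' _ => continuous_apply i') continuous_const
    · exact isClosed_iInter fun i' => isClosed_iInter fun _ =>
        isClosed_eq (continuous_apply i') continuous_const
  have hcompact : IsCompact (P.relaxedActions i j) :=
    IsCompact.of_isClosed_subset (isCompact_Icc (a := (0 : Fin I → ℝ)) (b := 1)) hclosed
      (fun a ha => ⟨fun i' => (ha.1 i').1, fun i' => (ha.1 i').2⟩)
  have hcont : Continuous (P.bellmanTerm γ i j t (P.value γ i j t.succ) s) := by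
    unfold bellmanTerm lagrangeCost mixedCost mixedTrans exploreProb
    fun_prop
  have hne : (P.relaxedActions i j).Nonempty :=
    ⟨0, fun _ => by simp, by simp, fun _ _ => rfl⟩
  have hv : P.value γ i j t.castSucc s =
      sInf (P.bellmanTerm γ i j t (P.value γ i j t.succ) s '' P.relaxedActions i j) := by
    simp [value]
  rw [hv]
  exact (hcompact.image hcont).isLeast_sInf (hne.image _)

/-- Deterministic actions of an area-agent pair. -/
def binaryActions (P : PatrolProblem I J T) (i : Fin I) (j : Fin J) : Set (Fin I → ℝ) :=
  {a | (∀ i', a i' = 0 ∨ a i' = 1) ∧ a ∈ P.relaxedActions i j}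

/-- Feasibility of `(γ, V)` for the linear program that is dual to the relaxed problem. -/
def DualFeasible (P : PatrolProblem I J T) (γ : Fin I → Fin J → Fin T → ℝ)
    (V : ∀ i j, Fin (T + 1) → P.State i j → ℝ) : Prop :=
  (∀ i j t s, ∀ a ∈ P.binaryActions i j,
    V i j t.castSucc s ≤ P.bellmanTerm γ i j t (V i j t.succ) s a) ∧
  ∀ i j s, V i j (Fin.last T) s = 0

/-- Objective of the dual linear program. -/
def dualObjective (P : PatrolProblem I J T) (V : ∀ i j, Fin (T + 1) → P.State i j → ℝ) : ℝ :=
  ∑ i, ∑ j, ∑ s, P.init i j s * V i j 0 s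

/-- `(γ, V)` is an optimal solution of the dual linear program. -/
def IsDualOptimal (P : PatrolProblem I J T) (γ : Fin I → Fin J → Fin T → ℝ)
    (V : ∀ i j, Fin (T + 1) → P.State i j → ℝ) : Prop :=
  P.DualFeasible γ V ∧ ∀ γ' V', P.DualFeasible γ' V' → P.dualObjective V' ≤ P.dualObjective V

/-- Marginal cost of exploring the area in state `s` at time `t`. -/
noncomputable def marginalCost (P : PatrolProblem I J T) (γ : Fin I → Fin J → Fin T → ℝ) (i : Fin I)
    (j : Fin J) (s : P.State i j) (t : Fin T) : ℝ :=
  P.cost i j s true t - P.cost i j s false t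
    + ∑ s', (P.trans i j t s true s' - P.trans i j t s false s') * P.value γ i j t.succ s'

/-- Index of the movement of a type-`j` agent from area `i'` to an area (or sub-area) `i` that is
in state `s` at time `t`. -/
noncomputable def index (P : PatrolProblem I J T) (γ : Fin I → Fin J → Fin T → ℝ) (i i' : Fin I)
    (j : Fin J) (s : P.State i j) (t : Fin T) : EReal :=
  if i' ∈ P.nbhd i j then ((P.marginalCost γ i j s t - γ i' j t : ℝ) : EReal) else ⊤

/-! ### The scaled problem and its constraints -/

/-- States of the patrol problem scaled by `h`: one state for each area `i`, type `j` and
sub-area number `k`. -/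
abbrev ScaledState (P : PatrolProblem I J T) (h : ℕ) : Type :=
  ∀ (i : Fin I) (j : Fin J), Fin h → P.State i j

/-- Number of type-`j` agents in area `i`. -/
def agents (P : PatrolProblem I J T) {h : ℕ} (s : P.ScaledState h) (j : Fin J) (i : Fin I) : ℕ :=
  ∑ k, P.indicator (s i j k)

/-- Number of agents (of type `j`) that the action moves from area `i` to its neighbourhood. -/
def placed (P : PatrolProblem I J T) {h : ℕ} (j : Fin J) (a : TypeAction I h) (i : Fin I) : ℕ :=
  ∑ i' ∈ P.nbhd i j, ∑ k, (a ((i', k), i)).toNat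

/-- Agents are only moved between neighbouring areas. -/
def MovesInNbhd (P : PatrolProblem I J T) {h : ℕ} (a : PatrolAction I J h) : Prop :=
  ∀ i k i' j, i' ∉ P.nbhd i j → a j ((i, k), i') = false

/-- Exclusivity constraint: at most one agent of each type is moved to a sub-area. -/
def Exclusive (P : PatrolProblem I J T) {h : ℕ} (a : PatrolAction I J h) : Prop :=
  ∀ i j k, ∑ i' ∈ P.nbhd i j, (a j ((i, k), i')).toNat ≤ 1

/-- Neighbourhood constraint in the state `s`: every agent is moved to a sub-area in the
neighbourhood of its present area. -/
def Neighbourhood (P : PatrolProblem I J T) {h : ℕ} (s : P.ScaledState h)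
    (a : PatrolAction I J h) : Prop :=
  ∀ i j, (1 / (h : ℝ)) * ∑ i' ∈ P.nbhd i j, ∑ k, ((a j ((i', k), i)).toNat : ℝ)
    = (1 / (h : ℝ)) * ∑ k, (P.indicator (s i j k) : ℝ)

/-! ### The index policy -/

/-- `L` ranks the possible movements of type `j`: ascending indices, and for movements to the same
sub-area with equal indices the smaller origin first; all other ties are broken arbitrarily. -/
def IsRanking (P : PatrolProblem I J T) (γ : Fin I → Fin J → Fin T → ℝ) {h : ℕ} (t : Fin T)
    (s : P.ScaledState h) (j : Fin J) (L : List (Movement I h)) : Prop :=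
  L.Nodup ∧
  (∀ x : Movement I h, x ∈ L ↔ 0 < P.agents s j x.2 ∧ x.2 ∈ P.nbhd x.1.1 j) ∧
  L.Pairwise (fun x y =>
    P.index γ x.1.1 x.2 j (s x.1.1 j x.1.2) t ≤ P.index γ y.1.1 y.2 j (s y.1.1 j y.1.2) t ∧
    (x.1 = y.1 →
      P.index γ x.1.1 x.2 j (s x.1.1 j x.1.2) t = P.index γ y.1.1 y.2 j (s y.1.1 j y.1.2) t →
      x.2 < y.2))

/-- Variables of the index algorithm: the action `act`, the markers `used` of the sub-areas that
already receive an agent, the numbers `left` of agents that are still to be moved. -/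
structure IndexVars (I h : ℕ) where
  act : TypeAction I h
  used : Slot I h → Bool
  left : Fin I → ℕ

/-- One pass of the loop of the index algorithm, for the movement `x`. -/
def indexStep {h : ℕ} (v : IndexVars I h) (x : Movement I h) : IndexVars I h :=
  if 1 ≤ v.left x.2 ∧ v.used x.1 = false then
    { act := Function.update v.act x true
      used := Function.update v.used x.1 true
      left := Function.update v.left x.2 (v.left x.2 - 1) }
  else v

/-- Action of the index policy for type `j` in the state `s`, from the ranked movements `L`. -/
def indexTypeAction (P : PatrolProblem I J T) {h : ℕ} (s : P.ScaledState h) (j : Fin J)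
    (L : List (Movement I h)) : TypeAction I h :=
  (L.foldl indexStep
    { act := fun _ => false, used := fun _ => false, left := fun i => P.agents s j i }).act

/-! ### Movement adaption -/

/-- Origin of the agent that the action moves to a sub-area. -/
def originOf {h : ℕ} (a : TypeAction I h) : Origin I h :=
  fun x => (List.finRange I).find? (fun i' => a (x, i'))

open Classical in
/-- The right-hand side of the equations that determine the distances to a vacant area. -/
noncomputable def distStep (P : PatrolProblem I J T) {h : ℕ} (s : P.ScaledState h) (j : Fin J)
    (ϖ : Origin I h) : (Fin I → ℕ∞) →o (Fin I → ℕ∞) where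
  toFun d i :=
    if 0 < P.agents s j i then
      if ∃ i' ∈ P.nbhd i j, ∃ k, ϖ (i', k) = none then 0
      else (⨅ o ∈ {o : Fin I | o ≠ i ∧ ∃ i' ∈ P.nbhd i j, ∃ k, ϖ (i', k) = some o}, d o) + 1
    else ⊤
  monotone' d d' hd i := by
    dsimp only
    split_ifs
    · exact le_rfl
    · exact add_le_add_left (iInf₂_mono fun o _ => hd o) 1
    · exact le_rfl

/-- Distance of each area to a vacant area: the (greatest) solution of the distance equations, which
is what one gets by starting from the distances `∞` and iterating. -/
noncomputable def dist (P : PatrolProblem I J T) {h : ℕ} (s : P.ScaledState h) (j : Fin J)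
    (ϖ : Origin I h) : Fin I → ℕ∞ :=
  (P.distStep s j ϖ).gfp

/-- The distances satisfy the distance equations. -/
theorem distStep_dist (P : PatrolProblem I J T) {h : ℕ} (s : P.ScaledState h) (j : Fin J)
    (ϖ : Origin I h) : P.distStep s j ϖ (P.dist s j ϖ) = P.dist s j ϖ :=
  OrderHom.map_gfp _

/-- The distance of the area from which a sub-area receives its agent. -/
def originDist {h : ℕ} (d : Fin I → ℕ∞) (ϖ : Origin I h) (x : Slot I h) : ℕ∞ :=
  (ϖ x).elim ⊤ d

/-- The sub-area `x` in the neighbourhood of area `b` minimises the distance of the origin, and its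
area has the smallest number among all minimisers. -/
def IsSelected (P : PatrolProblem I J T) {h : ℕ} (j : Fin J) (ϖ : Origin I h) (d : Fin I → ℕ∞)
    (b : Fin I) (x : Slot I h) : Prop :=
  x.1 ∈ P.nbhd b j ∧
  ∀ y : Slot I h, y.1 ∈ P.nbhd b j →
    originDist d ϖ x ≤ originDist d ϖ y ∧
    (originDist d ϖ y = originDist d ϖ x → x.1 ≤ y.1)

/-- `y` is a vacant sub-area in the neighbourhood of area `b`. -/
def IsVacant (P : PatrolProblem I J T) {h : ℕ} (j : Fin J) (ϖ : Origin I h) (b : Fin I)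
    (y : Slot I h) : Prop :=
  y.1 ∈ P.nbhd b j ∧ ϖ y = none

/-- All choices that the index policy and the movement adaption leave open: a ranking of the
movements, the order in which areas are treated, which of the selectable sub-areas is taken and which
vacant sub-area is filled. -/
structure TieBreak (P : PatrolProblem I J T) (γ : Fin I → Fin J → Fin T → ℝ) (h : ℕ) where
  rank : Fin T → P.ScaledState h → Fin J → List (Movement I h)
  rank_spec : ∀ t s j, P.IsRanking γ t s j (rank t s j)
  order : Fin T → P.ScaledState h → Fin J → List (Fin I)
  order_nodup : ∀ t s j, (order t s j).Nodup
  mem_order : ∀ t s j i, i ∈ order t s j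
  select : Fin T → P.ScaledState h → (j : Fin J) → Origin I h → (Fin I → ℕ∞) → Fin I → Slot I h
  select_spec : ∀ t s j ϖ d b, P.IsSelected j ϖ d b (select t s j ϖ d b)
  vacant : Fin T → P.ScaledState h → (j : Fin J) → Origin I h → Fin I → Slot I h
  vacant_spec : ∀ t s j ϖ b, (∃ y, P.IsVacant j ϖ b y) → P.IsVacant j ϖ b (vacant t s j ϖ b)

/-- Action of the index policy. -/
def indexAction (P : PatrolProblem I J T) {γ : Fin I → Fin J → Fin T → ℝ} {h : ℕ}
    (c : P.TieBreak γ h) (t : Fin T) (s : P.ScaledState h) : PatrolAction I J h :=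
  fun j => P.indexTypeAction s j (c.rank t s j)

/-- Variables of the movement adaption: `cur` is the area of the agent that currently has no place
(`none` when the while loop is to stop). -/
structure AdaptVars (I h : ℕ) where
  cur : Option (Fin I)
  origin : Origin I h
  act : TypeAction I h

open Classical in
/-- One pass of the while loop, with the distances `d`; the result is `none` if an instruction
cannot be carried out. -/
noncomputable def adaptStep (P : PatrolProblem I J T) {γ : Fin I → Fin J → Fin T → ℝ} {h : ℕ}
    (c : P.TieBreak γ h) (t : Fin T) (s : P.ScaledState h) (j : Fin J) (d : Fin I → ℕ∞)
    (v : AdaptVars I h) : Option (AdaptVars I h) :=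
  match v.cur with
  | none => some v
  | some b =>
    let x := c.select t s j v.origin d b
    match v.origin x with
    | none => none
    | some w =>
      let act' := Function.update (Function.update v.act (x, b) true) (x, w) false
      if d w = 0 then
        if ∃ y, P.IsVacant j v.origin w y then
          let y := c.vacant t s j v.origin w
          some { cur := none
                 origin := Function.update (Function.update v.origin y (some w)) x (some b)
                 act := Function.update act' (y, w) true }
        else none
      else
        some { cur := some w
               origin := Function.update v.origin x (some b)
               act := act' }

/-- `n` passes of the while loop (passes after the stop change nothing). -/
noncomputable def adaptIter (P : PatrolProblem I J T) {γ : Fin I → Fin J → Fin T → ℝ} {h : ℕ}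
    (c : P.TieBreak γ h) (t : Fin T) (s : P.ScaledState h) (j : Fin J) (d : Fin I → ℕ∞)
    (v : AdaptVars I h) : ℕ → Option (AdaptVars I h)
  | 0 => some v
  | n + 1 => (adaptIter P c t s j d v n).bind (P.adaptStep c t s j d)

open Classical in
/-- The while loop; the result is `none` if it does not stop or fails. -/
noncomputable def adaptWhile (P : PatrolProblem I J T) {γ : Fin I → Fin J → Fin T → ℝ} {h : ℕ}
    (c : P.TieBreak γ h) (t : Fin T) (s : P.ScaledState h) (j : Fin J) (d : Fin I → ℕ∞)
    (v : AdaptVars I h) : Option (AdaptVars I h) :=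
  if H : ∃ v' n, P.adaptIter c t s j d v n = some v' ∧ v'.cur = none then some H.choose else none

/-- Finding a place for `n` agents of area `i`, one after the other; the distances are computed anew
before each of them. -/
noncomputable def adaptArea (P : PatrolProblem I J T) {γ : Fin I → Fin J → Fin T → ℝ} {h : ℕ}
    (c : P.TieBreak γ h) (t : Fin T) (s : P.ScaledState h) (j : Fin J) (i : Fin I)
    (v : AdaptVars I h) : ℕ → Option (AdaptVars I h)
  | 0 => some v
  | n + 1 => (adaptArea P c t s j i v n).bind fun v' =>
      P.adaptWhile c t s j (P.dist s j v'.origin) { v' with cur := some i }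

/-- Area `i` has agents of type `j`, but the action `a` violates the neighbourhood constraint. -/
def IsDeficient (P : PatrolProblem I J T) {h : ℕ} (s : P.ScaledState h) (j : Fin J)
    (a : TypeAction I h) (i : Fin I) : Prop :=
  0 < P.agents s j i ∧ P.placed j a i ≠ P.agents s j i

instance decidableIsDeficient (P : PatrolProblem I J T) {h : ℕ} (s : P.ScaledState h) (j : Fin J)
    (a : TypeAction I h) : DecidablePred (P.IsDeficient s j a) :=
  fun _ => inferInstanceAs (Decidable (_ ∧ _))

/-- Movement adaption for type `j`: start from the action of the index policy, then treat one after
the other the areas that are deficient under it; in each, all agents without a place are placed. -/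
noncomputable def maiTypeAction (P : PatrolProblem I J T) {γ : Fin I → Fin J → Fin T → ℝ} {h : ℕ}
    (c : P.TieBreak γ h) (t : Fin T) (s : P.ScaledState h) (j : Fin J) :
    Option (TypeAction I h) :=
  let a₀ := P.indexAction c t s j
  (((c.order t s j).filter (fun i => decide (P.IsDeficient s j a₀ i))).foldlM
    (fun v i => P.adaptArea c t s j i v (P.agents s j i - P.placed j v.act i))
    { cur := none, origin := originOf a₀, act := a₀ }).map AdaptVars.act

/-- Action of the movement-adapted index (MAI) policy: movement adaption is carried out for each type
(the variables of different types do not interact).  The result is `none` if the algorithm fails or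
does not terminate. -/
noncomputable def maiAction (P : PatrolProblem I J T) {γ : Fin I → Fin J → Fin T → ℝ} {h : ℕ}
    (c : P.TieBreak γ h) (t : Fin T) (s : P.ScaledState h) : Option (PatrolAction I J h) :=
  if H : ∀ j, (P.maiTypeAction c t s j).isSome then
    some (fun j => (P.maiTypeAction c t s j).get (H j))
  else none

end PatrolProblem

open scoped BigOperators

namespace PatrolProblem

variable {I J T : ℕ}

/-! An action of either policy is encoded by a partial map from sub-areas to origins (`Realizes`).
Admissibility and exclusivity are built into this encoding, and the neighbourhood constraint says
that each area occurs as an origin as often as it has agents (`Realizes.placed_eq`).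

The index policy is greedy, hence maximal: if an area keeps an unmoved agent, every sub-area in its
neighbourhood is occupied (`IsRanking.exists_isPlacement`). Adaption never vacates a sub-area, so
this persists throughout.

Such an area has finite distance, by pigeonhole (`dist_ne_top`): the sub-areas of the populated
areas at infinite distance are all occupied, by agents from these same areas, and these areas have
no more agents than sub-areas, so none of their agents is left unmoved. Along the while loop the
distance of the current area drops by exactly one per pass. Sub-areas altered earlier in the loop
involve only larger distances and do not interfere, so the loop reaches a vacant sub-area
(`exists_adaptIter_eq_some`). The net effect is one more moved agent for the treated area and no
change for the others; hence the areas can be treated independently.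

The norm estimate needs no comparison of the two policies. Each action has at most one entry 1 per
type and sub-area, so the squared distance is at most `2 * I * J * h` (`norm_vec_sub_le`), and the
distance itself is of order √h, uniformly in time and state. -/

/-! ### Origin maps and the actions that realise them -/

/-- Number of sub-areas that receive an agent from area `o`. -/
def originCount {h : ℕ} (ϖ : Origin I h) (o : Fin I) : ℕ :=
  ∑ x, if ϖ x = some o then 1 else 0

/-- The lost and the gained contribution stand on opposite sides, which avoids truncated
subtraction. -/
theorem originCount_update {h : ℕ} (ϖ : Origin I h) (x : Slot I h) (v : Option (Fin I))
    (o : Fin I) :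
    originCount (Function.update ϖ x v) o + (if ϖ x = some o then 1 else 0) =
      originCount ϖ o + if v = some o then 1 else 0 := by
  unfold originCount
  rw [← Finset.add_sum_erase _ _ (Finset.mem_univ x),
    ← Finset.add_sum_erase _ (fun y => if ϖ y = some o then 1 else 0) (Finset.mem_univ x)]
  have : ∑ y ∈ Finset.univ.erase x, (if Function.update ϖ x v y = some o then 1 else 0) =
      ∑ y ∈ Finset.univ.erase x, if ϖ y = some o then 1 else 0 :=
    Finset.sum_congr rfl fun y hy => by
      rw [Function.update_of_ne (Finset.ne_of_mem_erase hy)]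
  rw [this, Function.update_self]
  omega

theorem originCount_pos {h : ℕ} {ϖ : Origin I h} {x : Slot I h} {o : Fin I}
    (hx : ϖ x = some o) : 0 < originCount ϖ o := by
  refine lt_of_lt_of_le Nat.one_pos ?_
  have := Finset.single_le_sum (f := fun y => if ϖ y = some o then 1 else 0)
    (fun y _ => Nat.zero_le _) (Finset.mem_univ x)
  simpa [originCount, hx] using this

theorem originCount_eq_card {h : ℕ} (ϖ : Origin I h) (o : Fin I) :
    originCount ϖ o = (Finset.univ.filter fun x => ϖ x = some o).card := by
  simp [originCount]

/-- The action `a` moves to each sub-area the agent prescribed by `ϖ`, and only between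
neighbouring areas. -/
structure Realizes (P : PatrolProblem I J T) {h : ℕ} (j : Fin J) (ϖ : Origin I h)
    (a : TypeAction I h) : Prop where
  act_iff : ∀ x i, a (x, i) = true ↔ ϖ x = some i
  mem_nbhd : ∀ x i, ϖ x = some i → i ∈ P.nbhd x.1 j

namespace Realizes

variable {P : PatrolProblem I J T} {h : ℕ} {j : Fin J} {ϖ : Origin I h} {a : TypeAction I h}

theorem toNat_act (H : P.Realizes j ϖ a) (x : Slot I h) (i : Fin I) :
    (a (x, i)).toNat = if ϖ x = some i then 1 else 0 := by
  have := H.act_iff x i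
  cases h' : a (x, i) <;> simp_all

theorem originOf_eq (H : P.Realizes j ϖ a) : originOf a = ϖ := by
  funext x
  unfold originOf
  cases hx : ϖ x with
  | none =>
    rw [List.find?_eq_none]
    intro i _ hi
    rw [H.act_iff, hx] at hi
    cases hi
  | some o =>
    cases hf : (List.finRange I).find? fun i => a (x, i) with
    | none =>
      rw [List.find?_eq_none] at hf
      exact absurd ((H.act_iff x o).2 hx) (hf o (List.mem_finRange o))
    | some i =>
      have hi := List.find?_some (p := fun i => a (x, i)) hf
      rw [H.act_iff, hx] at hi
      exact hi.symm

/-- By symmetry of neighbourhoods, sub-areas outside the neighbourhood of `i` receive nothing from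
`i`, so summing over all sub-areas changes nothing. -/
theorem placed_eq (H : P.Realizes j ϖ a) (i : Fin I) : P.placed j a i = originCount ϖ i := by
  unfold placed originCount
  rw [Fintype.sum_prod_type]
  simp only [H.toNat_act]
  refine Finset.sum_subset (Finset.subset_univ _) fun i' _ hi' => ?_
  refine Finset.sum_eq_zero fun k _ => if_neg fun hk => hi' ?_
  exact P.nbhd_symm _ _ _ (H.mem_nbhd _ _ hk)

theorem sum_toNat_act_le_one (H : P.Realizes j ϖ a) (x : Slot I h) :
    ∑ i, (a (x, i)).toNat ≤ 1 := by
  simp only [H.toNat_act]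
  cases ϖ x with
  | none => simp
  | some o => simp

theorem sum_act_le (H : P.Realizes j ϖ a) : ∑ y, (a y).toNat ≤ I * h := by
  rw [Fintype.sum_prod_type]
  calc ∑ x : Slot I h, ∑ i, (a (x, i)).toNat ≤ ∑ _x : Slot I h, 1 :=
        Finset.sum_le_sum fun x _ => H.sum_toNat_act_le_one x
    _ = I * h := by simp

/-- Changing the origin of one sub-area from none to `b`. -/
theorem fill (H : P.Realizes j ϖ a) {x : Slot I h} {b : Fin I} (hx : ϖ x = none)
    (hb : b ∈ P.nbhd x.1 j) :
    P.Realizes j (Function.update ϖ x (some b)) (Function.update a (x, b) true) where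
  act_iff y i := by
    have := H.act_iff y i
    by_cases hy : y = x
    · subst hy
      by_cases hi : i = b
      · simp [hi]
      · simp_all [Ne.symm hi]
    · simp [hy, this]
  mem_nbhd y i hi := by
    by_cases hy : y = x
    · subst hy
      simp only [Function.update_self, Option.some.injEq] at hi
      exact hi ▸ hb
    · rw [Function.update_of_ne hy] at hi
      exact H.mem_nbhd y i hi

/-- Changing the origin of one sub-area from `w` to `b`. -/
theorem replace (H : P.Realizes j ϖ a) {x : Slot I h} {b w : Fin I} (hx : ϖ x = some w)
    (hb : b ∈ P.nbhd x.1 j) (hbw : b ≠ w) :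
    P.Realizes j (Function.update ϖ x (some b))
      (Function.update (Function.update a (x, b) true) (x, w) false) where
  act_iff y i := by
    have := H.act_iff y i
    by_cases hy : y = x
    · subst hy
      by_cases hi : i = b
      · simp [hi, hbw]
      · by_cases hw : i = w
        · simp [hw, hbw]
        · simp_all [Ne.symm hi, Ne.symm hw]
    · simp [hy, this]
  mem_nbhd y i hi := by
    by_cases hy : y = x
    · subst hy
      simp only [Function.update_self, Option.some.injEq] at hi
      exact hi ▸ hb
    · rw [Function.update_of_ne hy] at hi
      exact H.mem_nbhd y i hi

end Realizes

/-- `a` moves at most as many agents as there are, and areas with unmoved agents have no vacant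
sub-area in their neighbourhood. -/
structure IsPlacement (P : PatrolProblem I J T) {h : ℕ} (s : P.ScaledState h) (j : Fin J)
    (ϖ : Origin I h) (a : TypeAction I h) : Prop extends P.Realizes j ϖ a where
  count_le : ∀ i, originCount ϖ i ≤ P.agents s j i
  not_vacant : ∀ i, originCount ϖ i < P.agents s j i → ∀ x : Slot I h, x.1 ∈ P.nbhd i j →
    ϖ x ≠ none

/-! ### The index policy -/

/-- The variables of the index algorithm are consistent with the origins `ϖ`. -/
structure IndexInvariant (P : PatrolProblem I J T) {h : ℕ} (s : P.ScaledState h) (j : Fin J)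
    (ϖ : Origin I h) (v : IndexVars I h) : Prop extends P.Realizes j ϖ v.act where
  used_iff : ∀ x, v.used x = false ↔ ϖ x = none
  count_add : ∀ i, originCount ϖ i + v.left i = P.agents s j i

theorem IndexInvariant.indexStep {P : PatrolProblem I J T} {h : ℕ} {s : P.ScaledState h}
    {j : Fin J} {ϖ : Origin I h} {v : IndexVars I h} (H : P.IndexInvariant s j ϖ v)
    {y : Movement I h} (hy : y.2 ∈ P.nbhd y.1.1 j) :
    ∃ ϖ', P.IndexInvariant s j ϖ' (indexStep v y) := by
  obtain ⟨x, b⟩ := y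
  unfold PatrolProblem.indexStep
  split_ifs with hc
  · have hx : ϖ x = none := (H.used_iff x).1 hc.2
    refine ⟨Function.update ϖ x (some b), H.toRealizes.fill hx hy, fun z => ?_, fun i => ?_⟩
    · by_cases hz : z = x
      · simp [hz]
      · simp [hz, H.used_iff z]
    · have h1 := originCount_update ϖ x (some b) i
      have h2 := H.count_add i
      have h3 := hc.1
      simp only [hx, reduceCtorEq, if_false, Option.some.injEq] at h1
      by_cases hi : i = b
      · subst hi
        simp only [Function.update_self, if_true] at h1 h3 ⊢
        omega
      · simp only [Function.update_of_ne hi, if_neg (Ne.symm hi)] at h1 ⊢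
        omega
  · exact ⟨ϖ, H⟩

/-- Markers are never cleared and the numbers of remaining agents never grow, so a movement that is
blocked once stays blocked. -/
theorem indexStep_mono {h : ℕ} (v : IndexVars I h) (y z : Movement I h)
    (hz : v.used z.1 = true ∨ v.left z.2 = 0) :
    (indexStep v y).used z.1 = true ∨ (indexStep v y).left z.2 = 0 := by
  unfold indexStep
  split_ifs with hc
  · rcases hz with hz | hz
    · left
      by_cases hzy : z.1 = y.1
      · simp [hzy]
      · simp [hzy, hz]
    · right
      by_cases hzy : z.2 = y.2
      · rw [← hzy] at hc ⊢
        simp [hz]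
      · simp [hzy, hz]
  · exact hz

theorem indexStep_self {h : ℕ} (v : IndexVars I h) (y : Movement I h) :
    (indexStep v y).used y.1 = true ∨ (indexStep v y).left y.2 = 0 := by
  unfold indexStep
  split_ifs with hc
  · simp
  · rcases Nat.eq_zero_or_pos (v.left y.2) with h0 | h0
    · exact Or.inr h0
    · left
      by_contra hu
      exact hc ⟨h0, by simpa using hu⟩

theorem foldl_indexStep_mono {h : ℕ} (L : List (Movement I h)) (v : IndexVars I h)
    (z : Movement I h) (hz : v.used z.1 = true ∨ v.left z.2 = 0) :
    (L.foldl indexStep v).used z.1 = true ∨ (L.foldl indexStep v).left z.2 = 0 := by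
  induction L generalizing v with
  | nil => exact hz
  | cons y L ih => exact ih _ (indexStep_mono v y z hz)

theorem foldl_indexStep_of_mem {h : ℕ} (L : List (Movement I h)) (v : IndexVars I h)
    (z : Movement I h) (hz : z ∈ L) :
    (L.foldl indexStep v).used z.1 = true ∨ (L.foldl indexStep v).left z.2 = 0 := by
  induction L generalizing v with
  | nil => cases hz
  | cons y L ih =>
    rcases List.mem_cons.1 hz with rfl | hz
    · exact foldl_indexStep_mono L _ _ (indexStep_self v z)
    · exact ih _ hz

theorem IndexInvariant.foldl {P : PatrolProblem I J T} {h : ℕ} {s : P.ScaledState h}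
    {j : Fin J} (L : List (Movement I h)) (hL : ∀ y ∈ L, y.2 ∈ P.nbhd y.1.1 j)
    {ϖ : Origin I h} {v : IndexVars I h} (H : P.IndexInvariant s j ϖ v) :
    ∃ ϖ', P.IndexInvariant s j ϖ' (L.foldl PatrolProblem.indexStep v) := by
  induction L generalizing ϖ v with
  | nil => exact ⟨ϖ, H⟩
  | cons y L ih =>
    obtain ⟨ϖ', H'⟩ := H.indexStep (hL y List.mem_cons_self)
    exact ih (fun z hz => hL z (List.mem_cons_of_mem _ hz)) H'

/-- After the loop each ranked movement is blocked, because its sub-area is taken or its area is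
exhausted. A vacant sub-area next to an area with an unmoved agent would give a ranked movement that
is not blocked. -/
theorem IsRanking.exists_isPlacement {P : PatrolProblem I J T}
    {γ : Fin I → Fin J → Fin T → ℝ} {h : ℕ} {t : Fin T} {s : P.ScaledState h} {j : Fin J}
    {L : List (Movement I h)} (hL : P.IsRanking γ t s j L) :
    ∃ ϖ, P.IsPlacement s j ϖ (P.indexTypeAction s j L) := by
  obtain ⟨ϖ, H⟩ := IndexInvariant.foldl (P := P) (s := s) (j := j) L
    (fun y hy => ((hL.2.1 y).1 hy).2) (ϖ := fun _ => none)
    (v := { act := fun _ => false, used := fun _ => false, left := fun i => P.agents s j i })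
    ⟨⟨by simp, by simp⟩, by simp, by simp [originCount]⟩
  refine ⟨ϖ, H.toRealizes, fun i => ?_, fun i hi x hx hn => ?_⟩
  · have := H.count_add i
    omega
  · have hmem : (x, i) ∈ L := (hL.2.1 (x, i)).2
      ⟨lt_of_le_of_lt (Nat.zero_le _) hi, P.nbhd_symm _ _ _ hx⟩
    have hc := H.count_add i
    rcases foldl_indexStep_of_mem L _ _ hmem with hu | hl
    · rw [(H.used_iff x).2 hn] at hu
      cases hu
    · rw [hl] at hc
      omega

/-! ### Distances -/

theorem dist_eq (P : PatrolProblem I J T) {h : ℕ} (s : P.ScaledState h) (j : Fin J)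
    (ϖ : Origin I h) {i : Fin I} (hi : 0 < P.agents s j i)
    (hv : ∀ x : Slot I h, x.1 ∈ P.nbhd i j → ϖ x ≠ none) :
    P.dist s j ϖ i = (⨅ o ∈ {o : Fin I | o ≠ i ∧ ∃ i' ∈ P.nbhd i j, ∃ k, ϖ (i', k) = some o},
      P.dist s j ϖ o) + 1 := by
  have h1 := congrFun (P.distStep_dist s j ϖ) i
  rw [← h1]
  change (if 0 < P.agents s j i then _ else _) = _
  rw [if_pos hi, if_neg]
  rintro ⟨i', hi', k, hk⟩
  exact hv (i', k) hi' hk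

theorem exists_isVacant_of_dist_eq_zero (P : PatrolProblem I J T) {h : ℕ} {s : P.ScaledState h}
    {j : Fin J} {ϖ : Origin I h} {i : Fin I} (hd : P.dist s j ϖ i = 0) :
    ∃ x, P.IsVacant j ϖ i x := by
  have h1 := congrFun (P.distStep_dist s j ϖ) i
  by_contra hv
  have hv' : ∀ x : Slot I h, x.1 ∈ P.nbhd i j → ϖ x ≠ none :=
    fun x hx hn => hv ⟨x, hx, hn⟩
  rcases Nat.eq_zero_or_pos (P.agents s j i) with h0 | h0
  · rw [hd] at h1
    change (if 0 < P.agents s j i then _ else _) = _ at h1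
    rw [if_neg (by omega)] at h1
    cases h1
  · rw [P.dist_eq s j ϖ h0 hv'] at hd
    exact absurd hd (by simp)

/-- A positive finite value can only come from the infimum branch of the distance equation. This
gives what the selection rule needs: the distance `n` is attained among the origins in the
neighbourhood, and none is smaller. -/
theorem dist_eq_succ (P : PatrolProblem I J T) {h : ℕ} {s : P.ScaledState h} {j : Fin J}
    {ϖ : Origin I h} {i : Fin I} {n : ℕ} (hd : P.dist s j ϖ i = (n + 1 : ℕ)) :
    (∀ x : Slot I h, x.1 ∈ P.nbhd i j → ϖ x ≠ none) ∧
    (∃ x : Slot I h, x.1 ∈ P.nbhd i j ∧ ∃ o, ϖ x = some o ∧ P.dist s j ϖ o = n) ∧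
    ∀ x : Slot I h, x.1 ∈ P.nbhd i j → ∀ o, ϖ x = some o → (n : ℕ∞) ≤ P.dist s j ϖ o := by
  have h1 := congrFun (P.distStep_dist s j ϖ) i
  have hi : 0 < P.agents s j i := by
    by_contra h0
    change (if 0 < P.agents s j i then _ else _) = _ at h1
    rw [if_neg h0, hd] at h1
    cases h1
  have hv : ∀ x : Slot I h, x.1 ∈ P.nbhd i j → ϖ x ≠ none := by
    intro x hx hn
    change (if 0 < P.agents s j i then _ else _) = _ at h1
    rw [if_pos hi, if_pos ⟨x.1, hx, x.2, hn⟩, hd] at h1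
    exact absurd h1.symm (by simp)
  have heq := P.dist_eq s j ϖ hi hv
  rw [hd, Nat.cast_succ] at heq
  have hinf := WithTop.add_right_cancel ENat.one_ne_top heq
  have hle : ∀ x : Slot I h, x.1 ∈ P.nbhd i j → ∀ o, ϖ x = some o →
      (n : ℕ∞) ≤ P.dist s j ϖ o := by
    intro x hx o ho
    -- The infimum leaves out `i` itself, but an origin equal to `i` has distance `n + 1` and
    -- respects the bound as well.
    by_cases hoi : o = i
    · rw [hoi, hd]
      exact_mod_cast Nat.le_succ n
    · rw [hinf]
      exact iInf₂_le (f := fun o _ => P.dist s j ϖ o) o ⟨hoi, x.1, hx, x.2, ho⟩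
  refine ⟨hv, ?_, hle⟩
  by_contra hne
  -- If no origin had distance exactly `n`, all would be at least `n + 1`, and so would their
  -- infimum `n`.
  have : ((n + 1 : ℕ) : ℕ∞) ≤ (n : ℕ∞) := by
    conv_rhs => rw [hinf]
    refine le_iInf₂ fun o ho => ?_
    obtain ⟨_, i', hi', k, hk⟩ := ho
    rw [Nat.cast_succ]
    exact Order.add_one_le_of_lt
      (lt_of_le_of_ne (hle (i', k) hi' o hk) fun h' => hne ⟨(i', k), hi', o, hk, h'.symm⟩)
  have := Nat.cast_le.1 this
  omega

theorem agents_le (P : PatrolProblem I J T) {h : ℕ} (s : P.ScaledState h) (j : Fin J)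
    (i : Fin I) : P.agents s j i ≤ h := by
  unfold agents
  calc ∑ k, P.indicator (s i j k) ≤ ∑ _k : Fin h, 1 :=
        Finset.sum_le_sum fun k _ => Bool.toNat_le _
    _ = h := by simp

/-- An area with unmoved agents has a finite distance: otherwise the agents of the areas at infinite
distance fill all sub-areas of these areas, which leaves none of them unmoved. -/
theorem dist_ne_top (P : PatrolProblem I J T) {h : ℕ} {s : P.ScaledState h} {j : Fin J}
    {ϖ : Origin I h} (hle : ∀ i, originCount ϖ i ≤ P.agents s j i) {i : Fin I}
    (hi : originCount ϖ i < P.agents s j i) : P.dist s j ϖ i ≠ ⊤ := by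
  classical
  intro htop
  -- Positivity is required because an area without agents has infinite distance by convention,
  -- whatever its neighbourhood looks like.
  set R : Finset (Fin I) :=
    Finset.univ.filter fun o => 0 < P.agents s j o ∧ P.dist s j ϖ o = ⊤ with hR
  have hiR : i ∈ R := by
    simp only [hR, Finset.mem_filter, Finset.mem_univ, true_and]
    exact ⟨by omega, htop⟩
  have hsub : R ×ˢ (Finset.univ : Finset (Fin h)) ⊆
      R.biUnion fun o => Finset.univ.filter fun x => ϖ x = some o := by
    rintro ⟨o, k⟩ hx
    obtain ⟨ho, -⟩ := Finset.mem_product.1 hx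
    obtain ⟨-, hpos, hdo⟩ := Finset.mem_filter.1 ho
    have hv : ∀ x : Slot I h, x.1 ∈ P.nbhd o j → ϖ x ≠ none := by
      intro x hx hn
      have h1 := congrFun (P.distStep_dist s j ϖ) o
      change (if 0 < P.agents s j o then _ else _) = _ at h1
      rw [if_pos hpos, if_pos ⟨x.1, hx, x.2, hn⟩, hdo] at h1
      cases h1
    obtain ⟨w, hw⟩ := Option.ne_none_iff_exists'.1 (hv (o, k) (P.self_mem_nbhd o j))
    have hdw : P.dist s j ϖ w = ⊤ := by
      by_cases hwo : w = o
      · rw [hwo, hdo]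
      · have heq := P.dist_eq s j ϖ hpos hv
        rw [hdo] at heq
        have hinf : (⨅ o' ∈ {o' : Fin I | o' ≠ o ∧ ∃ i' ∈ P.nbhd o j, ∃ k, ϖ (i', k) = some o'},
            P.dist s j ϖ o') = ⊤ := by
          by_contra hne
          exact (WithTop.add_ne_top.2 ⟨hne, ENat.one_ne_top⟩) heq.symm
        exact iInf₂_eq_top.1 hinf w ⟨hwo, o, P.self_mem_nbhd o j, k, hw⟩
    refine Finset.mem_biUnion.2 ⟨w, ?_, by simpa using hw⟩
    simp only [hR, Finset.mem_filter, Finset.mem_univ, true_and]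
    exact ⟨lt_of_lt_of_le (originCount_pos hw) (hle w), hdw⟩
  have h1 : R.card * h ≤ ∑ o ∈ R, originCount ϖ o := by
    calc R.card * h = (R ×ˢ (Finset.univ : Finset (Fin h))).card := by simp
      _ ≤ _ := Finset.card_le_card hsub
      _ ≤ ∑ o ∈ R, (Finset.univ.filter fun x => ϖ x = some o).card := Finset.card_biUnion_le
      _ = ∑ o ∈ R, originCount ϖ o := by simp only [originCount_eq_card]
  -- The unmoved agent of `i` makes the inequality strict and closes the contradictory chain of
  -- counts.
  have h2 : ∑ o ∈ R, originCount ϖ o < ∑ o ∈ R, P.agents s j o :=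
    Finset.sum_lt_sum (fun o _ => hle o) ⟨i, hiR, hi⟩
  have h3 : ∑ o ∈ R, P.agents s j o ≤ R.card * h := by
    simpa using Finset.sum_le_sum fun o (_ : o ∈ R) => P.agents_le s j o
  omega

/-! ### Movement adaption -/

section Adapt

variable {P : PatrolProblem I J T} {γ : Fin I → Fin J → Fin T → ℝ} {h : ℕ}
  (c : P.TieBreak γ h) (t : Fin T) (s : P.ScaledState h) (j : Fin J)

/-- The definition appends passes at the end, whereas the induction on the distance splits off the
first pass. -/
theorem adaptIter_succ' (d : Fin I → ℕ∞) (v : AdaptVars I h) (n : ℕ) :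
    P.adaptIter c t s j d v (n + 1) =
      (P.adaptStep c t s j d v).bind fun v' => P.adaptIter c t s j d v' n := by
  induction n with
  | zero => simp [adaptIter]
  | succ n ih =>
    rw [adaptIter, ih, Option.bind_assoc]
    rfl

theorem adaptIter_add_of_cur_eq_none {d : Fin I → ℕ∞} {v v' : AdaptVars I h} {n : ℕ}
    (hv : P.adaptIter c t s j d v n = some v') (hc : v'.cur = none) (m : ℕ) :
    P.adaptIter c t s j d v (n + m) = some v' := by
  induction m with
  | zero => exact hv
  | succ m ih =>
    rw [← Nat.add_assoc, adaptIter, ih]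
    simp [adaptStep, hc]

/-- A stopped state is stationary, so any two stopped runs agree after the sum of their lengths; the
state picked by choice is therefore this one. -/
theorem adaptWhile_eq_some {d : Fin I → ℕ∞} {v v' : AdaptVars I h} {n : ℕ}
    (hv : P.adaptIter c t s j d v n = some v') (hc : v'.cur = none) :
    P.adaptWhile c t s j d v = some v' := by
  have H : ∃ v' n, P.adaptIter c t s j d v n = some v' ∧ v'.cur = none := ⟨v', n, hv, hc⟩
  rw [adaptWhile, dif_pos H]
  obtain ⟨m, hm, hmc⟩ := H.choose_spec
  rw [← adaptIter_add_of_cur_eq_none c t s j hm hmc n, Nat.add_comm,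
    adaptIter_add_of_cur_eq_none c t s j hv hc m]

/-- In the while loop, distances decrease by one in each pass. -/
theorem exists_adaptIter_eq_some (ϖ₀ : Origin I h) (n : ℕ) (v : AdaptVars I h) (b : Fin I)
    (hb : v.cur = some b) (hd : P.dist s j ϖ₀ b = (n + 1 : ℕ))
    (H : P.Realizes j v.origin v.act)
    (hch : ∀ y, v.origin y = ϖ₀ y ∨ ∃ o o', ϖ₀ y = some o ∧ v.origin y = some o' ∧
      ((n + 1 : ℕ) : ℕ∞) ≤ P.dist s j ϖ₀ o ∧ ((n + 1 : ℕ) : ℕ∞) ≤ P.dist s j ϖ₀ o') :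
    ∃ m v', P.adaptIter c t s j (P.dist s j ϖ₀) v m = some v' ∧ v'.cur = none ∧
      P.Realizes j v'.origin v'.act ∧
      (∀ o, originCount v'.origin o = originCount v.origin o + if b = o then 1 else 0) ∧
      ∀ y, v'.origin y = none → v.origin y = none := by
  induction n using Nat.strong_induction_on generalizing v b with
  | _ n ih =>
  obtain ⟨-, ⟨z, hz, o, hzo, hdo⟩, hle⟩ := P.dist_eq_succ hd
  set d := P.dist s j ϖ₀
  -- Origins at altered sub-areas had distance at least `n + 1` when `ϖ₀` was in force. Hence the
  -- sub-area `z`, which witnesses distance `n`, is still untouched.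
  have hvz : v.origin z = some o := by
    rcases hch z with hz' | ⟨o₁, o₂, ho₁, -, hn, -⟩
    · rw [hz', hzo]
    · rw [hzo] at ho₁
      cases ho₁
      rw [hdo] at hn
      have := Nat.cast_le.1 hn
      omega
  obtain ⟨hx, hmin⟩ := c.select_spec t s j v.origin d b
  set x := c.select t s j v.origin d b with hx_def
  have hxz := (hmin z hz).1
  rw [originDist, originDist, hvz, Option.elim_some, hdo] at hxz
  obtain ⟨w, hw⟩ : ∃ w, v.origin x = some w := by
    cases hw : v.origin x with
    | none =>
      rw [hw] at hxz
      simp at hxz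
    | some w => exact ⟨w, rfl⟩
  rw [hw, Option.elim_some] at hxz
  -- Minimality against `z` gives `≤`. For `≥`, either `x` is untouched and `ϖ₀` gives the bound, or
  -- its present origin has distance at least `n + 1`.
  have hdw : d w = n := by
    refine le_antisymm hxz ?_
    rcases hch x with hx' | ⟨o₁, o₂, -, ho₂, -, hn⟩
    · exact hle x hx w (by rw [← hx', hw])
    · rw [hw] at ho₂
      cases ho₂
      exact le_trans (by exact_mod_cast Nat.le_succ n) hn
  have hbw : b ≠ w := by
    rintro rfl
    rw [hd] at hdw
    have := Nat.cast_inj.1 hdw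
    omega
  have H' := H.replace hw (P.nbhd_symm _ _ _ hx) hbw
  have hcount := fun i => originCount_update v.origin x (some b) i
  simp only [hw, Option.some.injEq] at hcount
  rcases Nat.eq_zero_or_pos n with h0 | h0
  · subst h0
    have hdw0 : d w = 0 := by simpa using hdw
    -- Only sub-areas that were occupied under `ϖ₀` have been altered, so a vacancy counted by the
    -- fixed distances is still vacant.
    have hvac : ∃ y, P.IsVacant j v.origin w y := by
      obtain ⟨y, hy, hyn⟩ := P.exists_isVacant_of_dist_eq_zero hdw0
      refine ⟨y, hy, ?_⟩
      rcases hch y with hy' | ⟨o₁, -, ho₁, -⟩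
      · rw [hy', hyn]
      · rw [hyn] at ho₁
        cases ho₁
    obtain ⟨hyw, hyn⟩ := c.vacant_spec t s j v.origin w hvac
    set y := c.vacant t s j v.origin w with hy_def
    have hyx : y ≠ x := by
      intro hyx
      rw [hyx, hw] at hyn
      cases hyn
    have hyn' : Function.update v.origin x (some b) y = none := by
      rw [Function.update_of_ne hyx, hyn]
    have H'' := H'.fill hyn' (P.nbhd_symm _ _ _ hyw)
    -- The algorithm writes `y` before `x`; the argument replaced at `x` first and then filled `y`.
    rw [Function.update_comm hyx.symm] at H''
    refine ⟨1, { cur := none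
                 origin := Function.update (Function.update v.origin y (some w)) x (some b)
                 act := Function.update (Function.update (Function.update v.act (x, b) true)
                  (x, w) false) (y, w) true }, ?_, rfl, H'', fun i => ?_, fun u hu => ?_⟩
    · simp only [adaptIter, Option.bind_some, adaptStep, hb, ← hx_def, hw, if_pos hdw0,
        if_pos hvac, ← hy_def]
    · have h1 := hcount i
      have h2 := originCount_update (Function.update v.origin x (some b)) y (some w) i
      rw [hyn', Function.update_comm hyx.symm] at h2
      simp only [Option.some.injEq, reduceCtorEq, if_false] at h2
      simp only
      omega
    · by_contra hne
      by_cases hux : u = x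
      · simp [hux] at hu
      · by_cases huy : u = y
        · simp [huy, hyx] at hu
        · simp [hux, huy] at hu
          exact hne hu
  · obtain ⟨n, rfl⟩ : ∃ m, n = m + 1 := ⟨n - 1, by omega⟩
    have hdw0 : d w ≠ 0 := by
      rw [hdw]
      simp
    have hle' : ((n + 1 : ℕ) : ℕ∞) ≤ ((n + 1 + 1 : ℕ) : ℕ∞) := by exact_mod_cast Nat.le_succ _
    obtain ⟨m, v', hm, hc, hre, hct, hva⟩ := ih n (by omega)
      { cur := some w
        origin := Function.update v.origin x (some b)
        act := Function.update (Function.update v.act (x, b) true) (x, w) false }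
      -- The next threshold is one lower. At `x` the new origin `b` exceeds it by one, and the
      -- origin under `ϖ₀` is either `w`, exactly at the threshold, or one already known to lie
      -- above it.
      w rfl hdw H' (fun y => by
        by_cases hyx : y = x
        · right
          rcases hch x with hx' | ⟨o₁, o₂, ho₁, -, hn, -⟩
          · refine ⟨w, b, by rw [hyx, ← hx', hw], by simp [hyx], hdw.ge, ?_⟩
            rw [hd]
            exact hle'
          · refine ⟨o₁, b, by rw [hyx, ho₁], by simp [hyx], hle'.trans hn, ?_⟩
            rw [hd]
            exact hle'
        · simp only [Function.update_of_ne hyx]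
          exact (hch y).imp_right fun ⟨o₁, o₂, h1, h2, h3, h4⟩ =>
            ⟨o₁, o₂, h1, h2, hle'.trans h3, hle'.trans h4⟩)
    refine ⟨m + 1, v', ?_, hc, hre, fun i => ?_, fun u hu => ?_⟩
    · rw [adaptIter_succ']
      simp only [adaptStep, hb, ← hx_def, hw, if_neg hdw0, Option.bind_some]
      exact hm
    · have h1 := hcount i
      have h2 := hct i
      simp only at h2
      omega
    · have hu' := hva u hu
      by_cases hux : u = x
      · simp [hux] at hu'
      · simpa [hux] using hu'

/-- Finding a place for one agent of area `i`. -/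
theorem exists_adaptWhile_eq_some {v : AdaptVars I h} (H : P.IsPlacement s j v.origin v.act)
    {i : Fin I} (hi : originCount v.origin i < P.agents s j i) :
    ∃ v', P.adaptWhile c t s j (P.dist s j v.origin) { v with cur := some i } = some v' ∧
      P.IsPlacement s j v'.origin v'.act ∧
      ∀ o, originCount v'.origin o = originCount v.origin o + if i = o then 1 else 0 := by
  obtain ⟨n, hn⟩ := ENat.ne_top_iff_exists.1 (P.dist_ne_top H.count_le hi)
  -- Distance zero would mean a vacant sub-area beside an unmoved agent, which a placement excludes.
  obtain ⟨n, rfl⟩ : ∃ m, n = m + 1 := by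
    cases n with
    | zero =>
      obtain ⟨x, hx, hxn⟩ := P.exists_isVacant_of_dist_eq_zero (by simpa using hn.symm)
      exact absurd hxn (H.not_vacant i hi x hx)
    | succ m => exact ⟨m, rfl⟩
  obtain ⟨m, v', hm, hc, hre, hct, hva⟩ := exists_adaptIter_eq_some c t s j v.origin n
    { v with cur := some i } i rfl hn.symm H.toRealizes fun y => Or.inl rfl
  refine ⟨v', adaptWhile_eq_some c t s j hm hc, ⟨hre, fun o => ?_, fun o ho x hx hxn => ?_⟩, hct⟩
  · have h1 := hct o
    have h2 := H.count_le o
    simp only at h1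
    by_cases hio : i = o
    · subst hio
      simp only [if_true] at h1
      omega
    · simp only [if_neg hio] at h1
      omega
  · have h1 := hct o
    simp only at h1
    exact H.not_vacant o (by omega) x hx (hva x hxn)

theorem exists_adaptArea_eq_some {v : AdaptVars I h} (H : P.IsPlacement s j v.origin v.act)
    (i : Fin I) (n : ℕ) (hi : originCount v.origin i + n ≤ P.agents s j i) :
    ∃ v', P.adaptArea c t s j i v n = some v' ∧ P.IsPlacement s j v'.origin v'.act ∧
      ∀ o, originCount v'.origin o = originCount v.origin o + if i = o then n else 0 := by
  induction n with
  | zero => exact ⟨v, rfl, H, by simp⟩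
  | succ n ih =>
    obtain ⟨v₁, h1, H1, hc1⟩ := ih (by omega)
    have := hc1 i
    rw [if_pos rfl] at this
    obtain ⟨v₂, h2, H2, hc2⟩ := exists_adaptWhile_eq_some c t s j H1 (i := i) (by omega)
    refine ⟨v₂, by simp [adaptArea, h1, h2], H2, fun o => ?_⟩
    rw [hc2, hc1]
    split_ifs <;> omega

/-- Treating one area leaves the counts of all others unchanged. The number of agents to place is
read off the current action, so a repeated visit would place none. -/
theorem exists_foldlM_adaptArea_eq_some (l : List (Fin I)) {v : AdaptVars I h}
    (H : P.IsPlacement s j v.origin v.act) :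
    ∃ v', l.foldlM (fun v i => P.adaptArea c t s j i v (P.agents s j i - P.placed j v.act i)) v =
        some v' ∧ P.IsPlacement s j v'.origin v'.act ∧
      ∀ o, originCount v'.origin o =
        if o ∈ l then P.agents s j o else originCount v.origin o := by
  induction l generalizing v with
  | nil => exact ⟨v, rfl, H, by simp⟩
  | cons i l ih =>
    have hle := H.count_le i
    obtain ⟨v₁, h1, H1, hc1⟩ := exists_adaptArea_eq_some c t s j H i
      (P.agents s j i - P.placed j v.act i) (by rw [H.placed_eq]; omega)
    obtain ⟨v₂, h2, H2, hc2⟩ := ih H1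
    refine ⟨v₂, by simpa [List.foldlM_cons, h1] using h2, H2, fun o => ?_⟩
    rw [hc2, hc1, H.placed_eq]
    by_cases hol : o ∈ l
    · simp [hol]
    · by_cases hio : i = o
      · subst hio
        simp only [hol, if_false, List.mem_cons_self, if_true]
        omega
      · simp [hol, hio, Ne.symm hio]

theorem exists_maiTypeAction_eq_some :
    ∃ a ϖ, P.maiTypeAction c t s j = some a ∧ P.Realizes j ϖ a ∧
      ∀ i, P.placed j a i = P.agents s j i := by
  obtain ⟨ϖ, H⟩ := (c.rank_spec t s j).exists_isPlacement
  change P.IsPlacement s j ϖ (P.indexAction c t s j) at H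
  obtain ⟨v, hv, Hv, hc⟩ := exists_foldlM_adaptArea_eq_some c t s j
    ((c.order t s j).filter fun i => decide (P.IsDeficient s j (P.indexAction c t s j) i))
    (v := { cur := none, origin := originOf (P.indexAction c t s j),
            act := P.indexAction c t s j }) (by simpa only [H.originOf_eq] using H)
  refine ⟨v.act, v.origin, ?_, Hv.toRealizes, fun i => ?_⟩
  · simp only [maiTypeAction]
    rw [hv]
    rfl
  · rw [Hv.placed_eq, hc]
    simp only [List.mem_filter, c.mem_order, true_and, decide_eq_true_eq]
    -- Treated areas are complete. An untreated area either has no agents, so that its count is zero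
    -- by `count_le`, or was already complete under the index policy.
    split_ifs with hdef
    · rfl
    · simp only [H.originOf_eq]
      have hle := H.count_le i
      rw [IsDeficient, H.placed_eq] at hdef
      by_contra hne
      exact hdef ⟨by omega, hne⟩

end Adapt

/-! ### Comparison of actions -/

/-- For entries in {0, 1}, the square of a difference is at most the sum of the entries, and each
action has at most `I * h` ones per type. -/
theorem norm_vec_sub_le (P : PatrolProblem I J T) {h : ℕ} {a b : PatrolAction I J h}
    {ϖ ρ : Fin J → Origin I h} (ha : ∀ j, P.Realizes j (ϖ j) (a j))
    (hb : ∀ j, P.Realizes j (ρ j) (b j)) :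
    ‖a.vec - b.vec‖ ^ 2 ≤ 2 * I * J * (h : ℝ) := by
  have hsum : ∀ {a : PatrolAction I J h} {ϖ : Fin J → Origin I h},
      (∀ j, P.Realizes j (ϖ j) (a j)) →
      ∑ x : Fin J × Movement I h, ((a x.1 x.2).toNat : ℝ) ≤ J * (I * h) := by
    intro a ϖ ha
    rw [Fintype.sum_prod_type]
    calc ∑ j, ∑ y, ((a j y).toNat : ℝ) ≤ ∑ _j : Fin J, ((I : ℝ) * h) :=
          Finset.sum_le_sum fun j _ => by exact_mod_cast (ha j).sum_act_le
      _ = J * (I * h) := by simp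
  rw [EuclideanSpace.norm_sq_eq]
  calc ∑ x, ‖(a.vec - b.vec) x‖ ^ 2
      ≤ ∑ x : Fin J × Movement I h, (((a x.1 x.2).toNat : ℝ) + (b x.1 x.2).toNat) := by
        refine Finset.sum_le_sum fun x _ => ?_
        simp only [PatrolAction.vec, PiLp.sub_apply]
        cases a x.1 x.2 <;> cases b x.1 x.2 <;> norm_num
    _ ≤ J * (I * h) + J * (I * h) := by
        rw [Finset.sum_add_distrib]
        exact add_le_add (hsum ha) (hsum hb)
    _ = 2 * I * J * (h : ℝ) := by ring

end PatrolProblem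

/-! ### From the square-root bound to the o(h) estimate, and the lemma itself -/

theorem exists_forall_norm_le_mul {C ε : ℝ} (hε : 0 < ε) :
    ∃ H : ℕ+, ∀ h : ℕ+, H ≤ h → ∀ r : ℝ, r ^ 2 ≤ C * (h : ℝ) → r ≤ ε * h := by
  -- Once `h` is at least `C / ε ^ 2`, one has `C * h ≤ (ε * h) ^ 2`.
  obtain ⟨n, hn⟩ := exists_nat_ge (C / ε ^ 2)
  refine ⟨n.succPNat, fun h hh r hr => ?_⟩
  have hpos : (0 : ℝ) < (h : ℕ) := by exact_mod_cast h.pos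
  have h1 : (n : ℝ) ≤ (h : ℕ) := by
    have : (n.succPNat : ℕ) ≤ h := hh
    rw [Nat.succPNat_coe] at this
    exact_mod_cast (Nat.le_succ n).trans this
  have h2 : C ≤ (h : ℕ) * ε ^ 2 := (div_le_iff₀ (by positivity)).1 (hn.trans h1)
  refine le_of_sq_le_sq ?_ (by positivity)
  nlinarith

theorem lemma3 {I J T : ℕ} (P : PatrolProblem I J T)
    (γ : Fin I → Fin J → Fin T → ℝ) (V : ∀ i j, Fin (T + 1) → P.State i j → ℝ)
    (hopt : P.IsDualOptimal γ V)
    (c : ∀ h : ℕ+, P.TieBreak γ h) :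
    ∃ mai : ∀ h : ℕ+, Fin T → P.ScaledState h → PatrolAction I J h,
      (∀ h t s, P.maiAction (c h) t s = some (mai h t s)) ∧
      (∀ h t s, P.MovesInNbhd (mai h t s)) ∧
      (∀ h t s, P.Exclusive (mai h t s)) ∧
      (∀ h t s, P.Neighbourhood s (mai h t s)) ∧
      (∀ ε : ℝ, 0 < ε → ∃ H : ℕ+, ∀ h : ℕ+, H ≤ h → ∀ (t : Fin T) (s : P.ScaledState h),
        ‖(mai h t s).vec - (P.indexAction (c h) t s).vec‖ ≤ ε * (h : ℝ)) := by
  choose mai ϖ hmai hreal hplaced using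
    fun (h : ℕ+) (t : Fin T) (s : P.ScaledState h) (j : Fin J) =>
      PatrolProblem.exists_maiTypeAction_eq_some (c h) t s j
  refine ⟨mai, fun h t s => ?_, fun h t s i k i' j hi' => ?_, fun h t s i j k => ?_,
    fun h t s i j => ?_, fun ε hε => ?_⟩
  · have H : ∀ j, (P.maiTypeAction (c h) t s j).isSome := fun j => by simp [hmai]
    rw [PatrolProblem.maiAction, dif_pos H]
    simp [hmai]
  · rw [← Bool.not_eq_true, (hreal h t s j).act_iff]
    exact fun hϖ => hi' ((hreal h t s j).mem_nbhd _ _ hϖ)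
  · exact (Finset.sum_le_sum_of_subset (Finset.subset_univ _)).trans
      ((hreal h t s j).sum_toNat_act_le_one (i, k))
  · have := hplaced h t s j i
    unfold PatrolProblem.placed PatrolProblem.agents at this
    congr 1
    exact_mod_cast this
  · obtain ⟨H, hH⟩ := exists_forall_norm_le_mul (C := 2 * I * J) hε
    refine ⟨H, fun h hh t s => hH h hh _ ?_⟩
    choose ρ hρ using fun j => ((c h).rank_spec t s j).exists_isPlacement
    exact P.norm_vec_sub_le (hreal h t s) fun j => (hρ j).toRealizes
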